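/- Let $\mathbb{F}_q$ be a finite field with $q$ elements, $A=\mathbb{F}_q[\theta]$, $k=\mathbb{F}_q(\theta)$, and let $k_\infty$ be the completion of $k$ at the infinite place. Put $L_0:=1$, $L_i:=(\theta-\theta^{q})\cdots(\theta-\theta^{q^i})$ and $D_0:=1$, $D_i:=\prod_{j=0}^{i-1}(\theta^{q^i}-\theta^{q^j})$. For an integer $n=\sum_i n_iq^i\ge 0$ with $0\le n_i\le q-1$, let $\Gamma_{n+1}:=\prod_i D_i^{n_i}\in A$ be the Carlitz factorial. An index of depth $r\ge 1$ is a tuple $\mathfrak{s}=(s_1,\dots,s_r)$ of positive integers; its weight is $\mathrm{wt}(\mathfrak{s})=\sum_i s_i$, its depth is $\mathrm{dep}(\mathfrak{s})=r$, and $\Gamma_{\mathfrak{s}}:=\Gamma_{s_1}\cdots\Gamma_{s_r}$. Set $$\zeta_A(\mathfrak{s}):=\sum\frac{1}{a_1^{s_1}\cdots a_r^{s_r}}\in k_\infty,\qquad \mathrm{Li}^\star_{\mathfrak{s}}(z_1,\dots,z_r):=\sum_{i_1\ge\cdots\ge i_r\ge 0}\frac{z_1^{q^{i_1}}\cdots z_r^{q^{i_r}}}{L_{i_1}^{s_1}\cdots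 L_{i_r}^{s_r}},$$ where $a_1,\dots,a_r$ run over the monic polynomials in $A$ with $\deg a_1>\cdots>\deg a_r$. Let $t$ be a variable independent of $\theta$, put $F_0:=1$ and $F_i:=\prod_{j=1}^{i}(t^{q^i}-\theta^{q^j})$. There is a (unique) sequence of polynomials $H_n\in A[t]$, $n\ge 0$ (the Anderson–Thakur polynomials) with $$\Bigl(1-\sum_{i\ge 0}\frac{F_i}{D_i|_{\theta=t}}x^{q^i}\Bigr)^{-1}=\sum_{n\ge 0}\frac{H_n}{\Gamma_{n+1}|_{\theta=t}}x^n .$$ Fix an index $\mathfrak{s}$ of depth $r\ge 1$. Write $H_{s_i-1}=\sum_{j=0}^{m_i}u_{ij}t^j$ with $u_{ij}\in A$ and $m_i=\deg_t H_{s_i-1}$. Let $J_{\mathfrak{s}}=\prod_{i=1}^r\{0,\dots,m_i\}$, and for $\mathbf{j}=(j_1,\dots,j_r)\in J_{\mathfrak{s}}$ put $\mathbf{u}_{\mathbf{j}}:=(u_{1j_1},\dots,u_{rj_r})\in A^r$ and $b_{\mathbf{j}}:=(-1)^{r-1}\theta^{j_1+\cdots+j_r}\in A$. For a word $P$ of length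 $r-1$ in the two symbols "," and "+", let $P(\mathfrak{s})$ be the tuple obtained from $(s_1,\dots,s_r)$ by inserting the $i$-th symbol of $P$ between $s_i$ and $s_{i+1}$, and let $P^\times(\mathbf{u})$ be the tuple obtained from $\mathbf{u}=(u_1,\dots,u_r)$ in the same way with "+" replaced by "×". Then, for all $\mathbf{j}\in J_{\mathfrak{s}}$ and all words $P$, the tuple $P(\mathfrak{s})$ is an index with $\mathrm{wt}(P(\mathfrak{s}))=\mathrm{wt}(\mathfrak{s})$ and $\mathrm{dep}(P(\mathfrak{s}))\le r$, $P^\times(\mathbf{u}_{\mathbf{j}})$ is a point of $A^{\mathrm{dep}(P(\mathfrak{s}))}$, and the series $\mathrm{Li}^\star_{P(\mathfrak{s})}(P^\times(\mathbf{u}_{\mathbf{j}}))$ converges in $k_\infty$; the series $\zeta_A(\mathfrak{s})$ converges in $k_\infty$; and $$\Gamma_{\mathfrak{s}}\,\zeta_A(\mathfrak{s})=\sum_{\mathbf{j}\in J_{\mathfrak{s}}}\ \sum_{P}\ b_{\mathbf{j}}\cdot(-1)^{\mathrm{dep}(P(\mathfrak{s}))-1}\,\mathrm{Li}^\star_{P(\mathfrak{s})}\bigl(P^\times(\mathbf{u}_{\mathbf{j}})\bigr).$$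 In particular $\Gamma_{\mathfrak{s}}\zeta_A(\mathfrak{s})=\sum_\ell b_\ell\cdot(-1)^{\mathrm{dep}(\mathfrak{s}_\ell)-1}\mathrm{Li}^\star_{\mathfrak{s}_\ell}(\mathbf{u}_\ell)$ is a finite sum with $b_\ell\in A$, $\mathbf{u}_\ell\in A^{\mathrm{dep}(\mathfrak{s}_\ell)}$, $\mathrm{wt}(\mathfrak{s}_\ell)=\mathrm{wt}(\mathfrak{s})$ and $\mathrm{dep}(\mathfrak{s}_\ell)\le r$. -/

import Mathlib

open Polynomial

noncomputable section

/-! Notation: `F` is the finite field with `q` elements, `A = F[X]` with `θ = X`, `k = RatFunc F`,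
and `k_∞ = RatFunc.CompletionAtInfty F` is the completion of `k` at the infinite place. -/

namespace CarlitzMZV

section Carlitz

variable (F : Type*) [Field F] [Fintype F]

/-- `q`, the cardinality of the constant field. -/
def q : ℕ := Fintype.card F

/-- `L_i = (θ - θ^q) (θ - θ^(q^2)) ⋯ (θ - θ^(q^i))`, with `L_0 = 1`. -/
def L (i : ℕ) : F[X] := ∏ j ∈ Finset.Icc 1 i, (X - X ^ (q F) ^ j)

/-- `D_i = ∏_{j = 0}^{i - 1} (θ^(q^i) - θ^(q^j))`, with `D_0 = 1`. -/
def D (i : ℕ) : F[X] := ∏ j ∈ Finset.range i, (X ^ (q F) ^ i - X ^ (q F) ^ j)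

/-- The Carlitz factorial `Γ_{n+1} = ∏_i D_i^{n_i}`, where `n = ∑ n_i q^i` with
`0 ≤ n_i ≤ q - 1`, so that `n_i = ⌊n / q^i⌋ mod q`.  Only indices `i ≤ n` can have `n_i ≠ 0`. -/
def gammaSucc (n : ℕ) : F[X] := ∏ i ∈ Finset.range (n + 1), D F i ^ (n / (q F) ^ i % q F)

/-- `Γ_𝔰 = Γ_{s_1} ⋯ Γ_{s_r}`, for positive `s_i`. -/
def gammaIndex {r : ℕ} (s : Fin r → ℕ) : F[X] := ∏ i, gammaSucc F (s i - 1)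

/-- `F_i = ∏_{j = 1}^{i} (t^(q^i) - θ^(q^j))` in `A[t] = F[X][X]`: the outer variable is `t`, the
inner one is `θ`. -/
def atF (i : ℕ) : F[X][X] := ∏ j ∈ Finset.Icc 1 i, (X ^ (q F) ^ i - C (X ^ (q F) ^ j))

/-- For `a ∈ A`, the polynomial `a|_{θ = t}` in `A[t]`. -/
def substT (a : F[X]) : F[X][X] := a.map C

/-- The embedding of `A[t]` into its field of fractions. -/
abbrev toFrac : F[X][X] →+* FractionRing F[X][X] := algebraMap _ _

/-- The power series `∑_{i ≥ 0} (F_i / D_i|_{θ = t}) x^(q^i)` over the fraction field of `A[t]`. -/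
def atSeries : PowerSeries (FractionRing F[X][X]) :=
  PowerSeries.mk fun n => ∑ i ∈ (Finset.range (n + 1)).filter (fun i => (q F) ^ i = n),
    toFrac F (atF F i) / toFrac F (substT F (D F i))

/-- `H` is the sequence of Anderson–Thakur polynomials `H_n ∈ A[t]`:
`(1 - ∑_i (F_i / D_i|_{θ = t}) x^(q^i))⁻¹ = ∑_n (H_n / Γ_{n+1}|_{θ = t}) x^n`. -/
def IsAndersonThakur (H : ℕ → F[X][X]) : Prop :=
  (1 - atSeries F)⁻¹ =
    PowerSeries.mk fun n => toFrac F (H n) / toFrac F (substT F (gammaSucc F n))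

end Carlitz

section Values

variable (F : Type*) [Field F] [Fintype F] [DecidableEq (RatFunc F)]

/-- The embedding of `A` into `k_∞`. -/
def toInfty : F[X] →+* RatFunc.CompletionAtInfty F :=
  (algebraMap (RatFunc F) (RatFunc.CompletionAtInfty F)).comp (algebraMap F[X] (RatFunc F))

/-- The tuples `(a_1, …, a_r)` of monic polynomials with `|a_1| > ⋯ > |a_r|`. -/
def MonicTuple (r : ℕ) : Type _ :=
  {a : Fin r → F[X] // (∀ i, (a i).Monic) ∧ StrictAnti fun i => (a i).natDegree}

/-- The general term `1 / (a_1^{s_1} ⋯ a_r^{s_r})` of the multiple zeta value. -/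
def zetaTerm {r : ℕ} (s : Fin r → ℕ) (a : MonicTuple F r) : RatFunc.CompletionAtInfty F :=
  1 / ∏ i, toInfty F (a.1 i) ^ s i

/-- The multiple zeta value `ζ_A(𝔰)`. -/
def zetaA {r : ℕ} (s : Fin r → ℕ) : RatFunc.CompletionAtInfty F :=
  ∑' a : MonicTuple F r, zetaTerm F s a

/-- The general term of the Carlitz multiple star polylogarithm,
`z_1^(q^(i_1)) ⋯ z_d^(q^(i_d)) / (L_{i_1}^{s_1} ⋯ L_{i_d}^{s_d})` with `i_1 ≥ ⋯ ≥ i_d ≥ 0`. -/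
def starTerm {d : ℕ} (s : Fin d → ℕ) (z : Fin d → RatFunc.CompletionAtInfty F)
    (i : {i : Fin d → ℕ // Antitone i}) : RatFunc.CompletionAtInfty F :=
  (∏ m, z m ^ (q F) ^ i.1 m) / ∏ m, toInfty F (L F (i.1 m)) ^ s m

/-- The Carlitz multiple star polylogarithm `Li*_𝔰(z_1, …, z_d)`, at points over `k_∞`. -/
def starLi {d : ℕ} (s : Fin d → ℕ) (z : Fin d → RatFunc.CompletionAtInfty F) :
    RatFunc.CompletionAtInfty F :=
  ∑' i : {i : Fin d → ℕ // Antitone i}, starTerm F s z i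

end Values

section Words

/-- The symbols `,` and `+`.  In a word acting on points, `plus` is read as `×`. -/
inductive Sep
  | comma
  | plus
  deriving DecidableEq

instance : Fintype Sep := ⟨{Sep.comma, Sep.plus}, fun x => by cases x <;> decide⟩

/-- The words of length `r - 1` in the two symbols; the symbol `w i` (`0 ≤ i < r - 1`) is inserted
between the entries `i` and `i + 1` (counted from `0`) of an `r`-tuple. -/
abbrev Word (r : ℕ) : Type := Fin (r - 1) → Sep

variable {r : ℕ}

/-- The number of entries of the tuple that results from inserting the symbols of `w` into an
`r`-tuple (`r ≥ 1`): one more than the number of commas. -/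
def Word.dep (w : Word r) : ℕ :=
  (Finset.univ.filter fun i => w i = Sep.comma).card + 1

/-- The position, in the resulting tuple, of the block that contains the entry `j`: the number of
commas to the left of the entry `j`. -/
def Word.block (w : Word r) (j : Fin r) : ℕ :=
  (Finset.univ.filter fun i : Fin (r - 1) => (i : ℕ) < j ∧ w i = Sep.comma).card

/-- `w(𝔰) = (s_1 w_1 s_2 w_2 ⋯ w_{r-1} s_r)`: the entries not separated by a comma are added. -/
def Word.addTuple (w : Word r) (s : Fin r → ℕ) : Fin w.dep → ℕ :=
  fun m => ∑ j ∈ Finset.univ.filter (fun j => w.block j = (m : ℕ)), s j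

/-- `w^×(𝐮) = (u_1 w_1^× u_2 w_2^× ⋯ w_{r-1}^× u_r)`: the entries not separated by a comma are
multiplied. -/
def Word.mulTuple {R : Type*} [CommMonoid R] (w : Word r) (u : Fin r → R) : Fin w.dep → R :=
  fun m => ∏ j ∈ Finset.univ.filter (fun j => w.block j = (m : ℕ)), u j

end Words

section Data

variable {F : Type*} [Field F] {r : ℕ}

/-- `J_𝔰 = {0, …, m_1} × ⋯ × {0, …, m_r}`, where `m_i` is the degree in `t` of `H_{s_i - 1}`. -/
def indexSet (H : ℕ → F[X][X]) (s : Fin r → ℕ) : Finset (Fin r → ℕ) :=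
  Fintype.piFinset fun i => Finset.range ((H (s i - 1)).natDegree + 1)

/-- `𝐮_𝐣 = (u_{1 j_1}, …, u_{r j_r})`, where `u_{ij} ∈ A` is the coefficient of `t^j` in
`H_{s_i - 1}`. -/
def point (H : ℕ → F[X][X]) (s : Fin r → ℕ) (j : Fin r → ℕ) : Fin r → F[X] :=
  fun i => (H (s i - 1)).coeff (j i)

/-- The coefficient `(-1)^{r-1} a_𝐣(θ) = (-1)^{r-1} θ^{j_1 + ⋯ + j_r} ∈ A`. -/
def coefficient (F : Type*) [Field F] (j : Fin r → ℕ) : F[X] := (-1) ^ (r - 1) * X ^ ∑ i, j i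

end Data

end CarlitzMZV

end

/-!
Write `S_d(s)` for the sum of `1 / a^s` over the monic polynomials `a` of degree `d`, so that
`ζ_A(𝔰)` is the sum of `S_{d_1}(s_1) ⋯ S_{d_r}(s_r)` over `d_1 > ⋯ > d_r ≥ 0`. The identity rests on
the theorem of Anderson and Thakur (`powerSum_eq_twistEval`): if `H_{s-1} = ∑_j u_j t^j`, then
`Γ_s S_d(s) = ∑_j θ^j u_j^{q^d} / L_d^s` for every `d`. Multiplying this out over the depth turns
`Γ_𝔰 ζ_A(𝔰)` into a combination, with coefficients `θ^{j_1 + ⋯ + j_r}`, of multiple polylogarithms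
summed over strictly decreasing exponents. Inclusion–exclusion over the positions where an antitone
tuple is constant (`sum_word_sign`, `hasSum_strictAnti`) rewrites a strict sum as an alternating sum
of star sums; a set of positions is a word, and being constant across the symbols `+` means
factoring through the blocks of the word.

For the theorem of Anderson and Thakur, the polynomial `1 - ∑_{i ≤ d} z^{q^i} / (D_i L_{d-i}^{q^i})`
has the monic polynomials of degree `d` as its roots (`carlitzPoly_eq_prod`). Its nonconstant part
is `F`-linear and satisfies a functional equation under `z ↦ θ z` (`carlitzMap_X_mul`), which gives
its values at the powers of `θ`. Its derivative is the constant `-1 / L_d`, so logarithmic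
differentiation yields a recursion for `S_d(n + 1)` in `n` (`powerSum_succ`). The generating series
of the `H_n` yields a recursion of the same shape for `H_n / Γ_{n+1}` (`map_atH_div`), which after
the substitution `θ ↦ θ^{q^d}`, `t ↦ θ` becomes the one for `S_d(n + 1) L_d^{n+1}`
(`twistEval_atF`). That the `H_n` have
polynomial coefficients comes from `D_i Γ_{n-q^i+1} ∣ Γ_{n+1}`, which follows from an analogue of
Legendre's formula (`gammaSucc_eq_prod_bracket`).

The recursion also bounds the degree in `θ` of `H_{s-1}` by `(s - 1) q / (q - 1)`
(`thetaDegLE_atH`), while `L_i` has degree `q (q^i - 1) / (q - 1)`; hence the terms of the star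
series tend to zero, which in the complete nonarchimedean field `k_∞` is summability.
-/

noncomputable section

namespace CarlitzMZV

/-! ### Summability in the completion at infinity -/

section Valuation

open WithZero

instance nonarchimedeanRing_of_valued {R Γ : Type*} [Ring R]
    [LinearOrderedCommGroupWithZero Γ] [hv : Valued R Γ] : NonarchimedeanRing R where
  is_nonarchimedean U hU := by
    obtain ⟨γ, hγ⟩ := Valued.mem_nhds_zero.mp hU
    refine ⟨⟨(Valued.v.restrict : Valuation R _).ltAddSubgroup γ, ?_⟩, hγ⟩
    exact Valued.isOpen_ball R γ.1

variable (F : Type*) [Field F] [DecidableEq (RatFunc F)]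

instance : CompleteSpace (RatFunc.CompletionAtInfty F) := by
  let := (RatFunc.inftyValued F).toUniformSpace
  exact inferInstanceAs (CompleteSpace (UniformSpace.Completion (RatFunc F)))

variable {F}

lemma valuation_toInfty {a : F[X]} (ha : a ≠ 0) :
    Valued.v (toInfty F a) = exp (a.natDegree : ℤ) := by
  rw [← RatFunc.inftyValuation.polynomial F ha]
  let := RatFunc.inftyValued F
  exact Valued.valuedCompletion_apply (K := RatFunc F) _

lemma valuation_toInfty_le (a : F[X]) :
    Valued.v (toInfty F a) ≤ exp (a.natDegree : ℤ) := by
  by_cases ha : a = 0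
  · simp [ha]
  · exact (valuation_toInfty ha).le

lemma toInfty_injective : Function.Injective (toInfty F) :=
  (algebraMap (RatFunc F) (RatFunc.CompletionAtInfty F)).injective.comp
    (IsFractionRing.injective F[X] (RatFunc F))

lemma toInfty_ne_zero {a : F[X]} (ha : a ≠ 0) : toInfty F a ≠ 0 :=
  (map_ne_zero_iff _ toInfty_injective).mpr ha

/-- A family is summable when its valuations decrease along a size function that has only finitely
many arguments of each bounded size. -/
lemma summable_of_valuation_le {ι : Type*} (f : ι → RatFunc.CompletionAtInfty F) (h : ι → ℕ)
    (c : ℤ) (hh : ∀ N, {x | h x ≤ N}.Finite) (hf : ∀ x, Valued.v (f x) ≤ exp (c - h x)) :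
    Summable f := by
  refine NonarchimedeanAddGroup.summable_of_tendsto_cofinite_zero ?_
  rw [(Valued.hasBasis_nhds_zero _ _).tendsto_right_iff]
  intro γ _
  set e := MonoidWithZeroHom.ValueGroup₀.embedding γ.1 with he
  have he0 : e ≠ 0 := by simp [he]
  refine (hh (c - log e).toNat).subset fun x hx => ?_
  simp only [Set.mem_compl_iff, Set.mem_ofPred_eq, Valuation.restrict_lt_iff_lt_embedding,
    not_lt] at hx ⊢
  have := (log_le_log (y := exp (c - (h x : ℤ))) he0 (by simp)).mpr (hx.trans (hf x))
  rw [log_exp] at this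
  omega

end Valuation

/-! ### Powers of the Frobenius -/

section Frobenius

variable (F : Type*) [Field F] [Fintype F]

lemma one_lt_q : 1 < q F := Fintype.one_lt_card

lemma q_pos : 0 < q F := Fintype.card_pos

lemma q_pow_pos (i : ℕ) : 0 < q F ^ i := pow_pos (q_pos F) i

/-- The `q ^ n`-power map, as an endomorphism of an algebra over the field with `q` elements. -/
def powHom (R : Type*) [CommRing R] [Algebra F R] (n : ℕ) : R →ₐ[F] R :=
  FiniteField.frobeniusAlgHom F R ^ n

@[simp]
lemma powHom_apply {R : Type*} [CommRing R] [Algebra F R] (n : ℕ) (x : R) :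
    powHom F R n x = x ^ q F ^ n := by
  induction n with
  | zero => simp [powHom]
  | succ n ih =>
    rw [powHom, pow_succ', AlgHom.mul_apply]
    change FiniteField.frobeniusAlgHom F R (powHom F R n x) = _
    rw [ih, FiniteField.coe_frobeniusAlgHom]
    change (x ^ q F ^ n) ^ q F = _
    rw [← pow_mul, pow_succ]

lemma sub_pow_q_pow {R : Type*} [CommRing R] [Algebra F R] (n : ℕ) (x y : R) :
    (x - y) ^ q F ^ n = x ^ q F ^ n - y ^ q F ^ n := by
  simpa using map_sub (powHom F R n) x y

lemma sum_pow_q {R ι : Type*} [CommRing R] [Algebra F R] (t : Finset ι) (f : ι → R) :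
    (∑ i ∈ t, f i) ^ q F = ∑ i ∈ t, f i ^ q F := by
  have := map_sum (powHom F R 1) f t
  simp only [powHom_apply, pow_one] at this
  exact this

lemma q_cast_eq_zero {R : Type*} [CommRing R] [Algebra F R] : (q F : R) = 0 := by
  rw [← map_natCast (algebraMap F R), q, FiniteField.cast_card_eq_zero, map_zero]

end Frobenius

/-! ### Divisibility of Carlitz factorials -/

section Factorial

variable (F : Type*) [Field F] [Fintype F]

/-- The polynomial `[e] = θ^(q^e) - θ`. -/
def bracket (e : ℕ) : F[X] := X ^ q F ^ e - X

omit [Fintype F] in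
lemma X_pow_sub_X_pow_ne_zero {a b : ℕ} (h : a ≠ b) : (X ^ a - X ^ b : F[X]) ≠ 0 := by
  rw [sub_ne_zero]
  intro h'
  exact h (by simpa using congrArg natDegree h')

lemma q_pow_injective : Function.Injective (q F ^ ·) := Nat.pow_right_injective (one_lt_q F)

lemma bracket_ne_zero {e : ℕ} (he : e ≠ 0) : bracket F e ≠ 0 := by
  have := X_pow_sub_X_pow_ne_zero F (a := q F ^ e) (b := 1)
    (by simpa using (q_pow_injective F).ne he)
  simpa [bracket] using this

lemma D_ne_zero (i : ℕ) : D F i ≠ 0 := by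
  refine Finset.prod_ne_zero_iff.mpr fun j hj => X_pow_sub_X_pow_ne_zero F ?_
  exact (q_pow_injective F).ne (Finset.mem_range.mp hj).ne'

lemma L_ne_zero (i : ℕ) : L F i ≠ 0 := by
  refine Finset.prod_ne_zero_iff.mpr fun j hj => ?_
  have := bracket_ne_zero F (e := j) (by have := Finset.mem_Icc.mp hj; omega)
  rw [← neg_ne_zero]
  simpa [bracket] using this

@[simp] lemma D_zero : D F 0 = 1 := by simp [D]

@[simp] lemma L_zero : L F 0 = 1 := by simp [L]

lemma D_succ (i : ℕ) : D F (i + 1) = bracket F (i + 1) * D F i ^ q F := by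
  rw [D, Finset.prod_range_succ', D, ← Finset.prod_pow, mul_comm]
  congr 1
  · simp [bracket]
  · refine Finset.prod_congr rfl fun j _ => ?_
    have := sub_pow_q_pow F 1 (X ^ q F ^ i : F[X]) (X ^ q F ^ j)
    rw [pow_one] at this
    rw [this, ← pow_mul, ← pow_mul, pow_succ, pow_succ]

lemma L_succ (i : ℕ) : L F (i + 1) = L F i * (X - X ^ q F ^ (i + 1)) := by
  rw [L, Finset.prod_Icc_succ_top (by omega)]; rfl

/-- The analogue of Legendre's formula, for `D_i`. -/
lemma D_eq_prod_bracket (i N : ℕ) (hN : i ≤ N) :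
    D F i = ∏ e ∈ Finset.range N, bracket F (e + 1) ^ (q F ^ i / q F ^ (e + 1)) := by
  have key : D F i = ∏ e ∈ Finset.range i, bracket F (e + 1) ^ (q F ^ i / q F ^ (e + 1)) := by
    clear hN
    induction i with
    | zero => simp
    | succ i ih =>
      rw [D_succ, ih, ← Finset.prod_pow, Finset.prod_range_succ, mul_comm,
        Nat.div_self (q_pow_pos F _), pow_one]
      congr 1
      refine Finset.prod_congr rfl fun e he => ?_
      rw [← pow_mul, pow_succ (q F) i, Nat.div_mul_right_comm]
      exact pow_dvd_pow _ (Finset.mem_range.mp he)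
  rw [key]
  refine Finset.prod_subset (by simpa) fun e _ he => ?_
  rw [Nat.div_eq_of_lt (Nat.pow_lt_pow_right (one_lt_q F) (by simp at he; omega)), pow_zero]

lemma sum_digit_mul_pow (b m N : ℕ) :
    ∑ i ∈ Finset.range N, b ^ i * (m / b ^ i % b) = m % b ^ N := by
  induction N with
  | zero => simp [Nat.mod_one]
  | succ N ih => rw [Finset.sum_range_succ, ih, Nat.mod_pow_succ]

/-- The analogue of Legendre's formula `v_p(n!) = ∑ ⌊n / p^e⌋`. -/
lemma gammaSucc_eq_prod_bracket (n N : ℕ) (hN : n ≤ N) :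
    gammaSucc F n = ∏ e ∈ Finset.range N, bracket F (e + 1) ^ (n / q F ^ (e + 1)) := by
  have hD : ∀ i ∈ Finset.range (n + 1), D F i ^ (n / q F ^ i % q F) =
      ∏ e ∈ Finset.range N,
        bracket F (e + 1) ^ (q F ^ i / q F ^ (e + 1) * (n / q F ^ i % q F)) := by
    intro i hi
    rw [D_eq_prod_bracket F i N (by simp at hi; omega), ← Finset.prod_pow]
    simp only [pow_mul]
  rw [gammaSucc, Finset.prod_congr rfl hD, Finset.prod_comm]
  refine Finset.prod_congr rfl fun e he => ?_
  rw [Finset.prod_pow_eq_pow_sum]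
  congr 1
  by_cases hen : e + 1 ≤ n + 1
  · obtain ⟨k, hk⟩ := Nat.exists_eq_add_of_le hen
    rw [hk, Finset.sum_range_add, Finset.sum_eq_zero, zero_add]
    · have h1 : ∀ i ∈ Finset.range k, q F ^ (e + 1 + i) / q F ^ (e + 1) *
          (n / q F ^ (e + 1 + i) % q F) = q F ^ i * (n / q F ^ (e + 1) / q F ^ i % q F) := by
        intro i _
        rw [pow_add, Nat.mul_div_cancel_left _ (q_pow_pos F _), Nat.div_div_eq_div_mul]
      rw [Finset.sum_congr rfl h1, sum_digit_mul_pow, Nat.mod_eq_of_lt]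
      rw [Nat.div_lt_iff_lt_mul (q_pow_pos F _), ← pow_add, add_comm k, ← hk]
      exact (Nat.lt_succ_self n).trans (Nat.lt_pow_self (one_lt_q F))
    · intro i hi
      rw [Nat.div_eq_of_lt (Nat.pow_lt_pow_right (one_lt_q F) (Finset.mem_range.mp hi)), zero_mul]
  · rw [Finset.sum_eq_zero, Nat.div_eq_of_lt]
    · exact (show n < e + 1 by omega).trans (Nat.lt_pow_self (one_lt_q F))
    · intro i hi
      rw [Nat.div_eq_of_lt (Nat.pow_lt_pow_right (one_lt_q F) (by simp at hi; omega)), zero_mul]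

lemma gammaSucc_ne_zero (n : ℕ) : gammaSucc F n ≠ 0 :=
  Finset.prod_ne_zero_iff.mpr fun i _ => pow_ne_zero _ (D_ne_zero F i)

@[simp] lemma gammaSucc_zero : gammaSucc F 0 = 1 := by simp [gammaSucc]

lemma D_mul_gammaSucc_dvd {n i : ℕ} (h : q F ^ i ≤ n) :
    D F i * gammaSucc F (n - q F ^ i) ∣ gammaSucc F n := by
  have hi : i ≤ n := (Nat.lt_pow_self (one_lt_q F)).le.trans h
  rw [D_eq_prod_bracket F i n hi, gammaSucc_eq_prod_bracket F (n - q F ^ i) n (by omega),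
    gammaSucc_eq_prod_bracket F n n le_rfl, ← Finset.prod_mul_distrib]
  refine Finset.prod_dvd_prod_of_dvd _ _ fun e _ => ?_
  rw [← pow_add]
  refine pow_dvd_pow _ (Nat.div_add_div_le_add_div.trans ?_)
  rw [Nat.add_sub_cancel' h]

/-- The quotient `Γ_{n+1} / (D_i Γ_{n-q^i+1})`, an analogue of a binomial coefficient; it is a
polynomial when `q^i ≤ n`. -/
def gammaQuot (n i : ℕ) : F[X] := gammaSucc F n / (D F i * gammaSucc F (n - q F ^ i))

lemma gammaQuot_mul {n i : ℕ} (h : q F ^ i ≤ n) :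
    gammaQuot F n i * (D F i * gammaSucc F (n - q F ^ i)) = gammaSucc F n :=
  (mul_comm _ _).trans (EuclideanDomain.mul_div_cancel'
    (mul_ne_zero (D_ne_zero F i) (gammaSucc_ne_zero F _)) (D_mul_gammaSucc_dvd F h))

end Factorial

/-! ### Multiplication by a lacunary power series -/

section Series

/-- Multiplication of a power series by `∑ c_i x^(b^i)`. -/
lemma coeff_mk_pow_mul {K : Type*} [CommRing K] {b : ℕ} (hb : 1 < b) (c h : ℕ → K) (n : ℕ) :
    (PowerSeries.mk (fun m => ∑ i ∈ (Finset.range (m + 1)).filter (fun i => b ^ i = m), c i) *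
      PowerSeries.mk h).coeff n =
    ∑ i ∈ (Finset.range (n + 1)).filter (fun i => b ^ i ≤ n), c i * h (n - b ^ i) := by
  rw [PowerSeries.coeff_mul, Finset.Nat.sum_antidiagonal_eq_sum_range_succ_mk]
  simp only [PowerSeries.coeff_mk]
  simp only [Finset.sum_filter, Finset.sum_mul]
  have h1 : ∀ m ∈ Finset.range n.succ, ∑ i ∈ Finset.range (m + 1),
      (if b ^ i = m then c i else 0) * h (n - m) =
      ∑ i ∈ Finset.range (n + 1), (if b ^ i = m then c i else 0) * h (n - m) := by
    intro m hm
    refine Finset.sum_subset (by simp at hm ⊢; omega) fun i _ hi => ?_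
    rw [if_neg, zero_mul]
    rintro rfl
    exact hi (Finset.mem_range.mpr ((Nat.lt_pow_self hb).trans (Nat.lt_succ_self _)))
  rw [Finset.sum_congr rfl h1, Finset.sum_comm]
  refine Finset.sum_congr rfl fun i _ => ?_
  simp only [ite_mul, zero_mul, Finset.sum_ite_eq, Finset.mem_range, Nat.lt_succ_iff]

end Series

/-! ### The Anderson–Thakur polynomials -/

section AndersonThakur

variable (F : Type*) [Field F] [Fintype F]

/-- The Anderson–Thakur polynomials `H_n`, defined by the recursion
`H_n = ∑_{q^i ≤ n} (Γ_{n+1} / (D_i Γ_{n-q^i+1}))|_{θ=t} F_i H_{n-q^i}` that comes from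
multiplying out their generating series. -/
def atH (n : ℕ) : F[X][X] :=
  if n = 0 then 1 else
    ∑ i : Fin (n + 1), if _h : q F ^ (i : ℕ) ≤ n then
      have := q_pow_pos F i
      substT F (gammaQuot F n i) * atF F i * atH (n - q F ^ (i : ℕ)) else 0
termination_by n

@[simp] lemma atH_zero : atH F 0 = 1 := by rw [atH, if_pos rfl]

lemma atH_of_pos {n : ℕ} (hn : 0 < n) :
    atH F n = ∑ i ∈ (Finset.range (n + 1)).filter (fun i => q F ^ i ≤ n),
      substT F (gammaQuot F n i) * atF F i * atH F (n - q F ^ i) := by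
  rw [atH, if_neg hn.ne', Finset.sum_filter, Finset.sum_range]
  rfl

/-- A ring homomorphism from `A[t]` turns the recursion for `H_n` into the recursion for the
coefficients `H_n / Γ_{n+1}`. -/
lemma map_atH_div {K : Type*} [Field K] (φ : F[X][X] →+* K)
    (hφ : ∀ a : F[X], a ≠ 0 → φ (substT F a) ≠ 0) {n : ℕ} (hn : 0 < n) :
    φ (atH F n) / φ (substT F (gammaSucc F n)) =
      ∑ i ∈ (Finset.range (n + 1)).filter (fun i => q F ^ i ≤ n),
        φ (atF F i) / φ (substT F (D F i)) *
          (φ (atH F (n - q F ^ i)) / φ (substT F (gammaSucc F (n - q F ^ i)))) := by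
  rw [atH_of_pos F hn, map_sum, Finset.sum_div]
  refine Finset.sum_congr rfl fun i hi => ?_
  have h := congrArg (fun a => φ (substT F a)) (gammaQuot_mul F (Finset.mem_filter.mp hi).2)
  simp only [substT, Polynomial.map_mul, map_mul] at h
  have h0 := hφ _ (gammaSucc_ne_zero F n)
  have h1 := hφ _ (gammaSucc_ne_zero F (n - q F ^ i))
  have h2 := hφ _ (D_ne_zero F i)
  simp only [substT, map_mul] at h0 h1 h2 ⊢
  rw [div_mul_div_comm, div_eq_div_iff h0 (mul_ne_zero h2 h1), ← h]
  ring

theorem isAndersonThakur_atH : IsAndersonThakur F (atH F) := by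
  have hinj : ∀ a : F[X], a ≠ 0 → toFrac F (substT F a) ≠ 0 := fun a ha => by
    rw [map_ne_zero_iff _ (IsFractionRing.injective _ _), substT,
      Polynomial.map_ne_zero_iff (C_injective)]
    exact ha
  have hc : PowerSeries.constantCoeff (1 - atSeries F) ≠ 0 := by
    rw [map_sub, ← PowerSeries.coeff_zero_eq_constantCoeff_apply (atSeries F), atSeries,
      PowerSeries.coeff_mk, Finset.filter_false_of_mem fun i _ => (q_pow_pos F i).ne']
    simp
  rw [IsAndersonThakur, PowerSeries.inv_eq_iff_mul_eq_one hc, mul_comm, sub_mul, one_mul]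
  ext n
  rw [map_sub, atSeries, coeff_mk_pow_mul (one_lt_q F), PowerSeries.coeff_mk,
    PowerSeries.coeff_one]
  rcases Nat.eq_zero_or_pos n with rfl | hn
  · rw [Finset.sum_eq_zero]
    · simp [substT]
    · intro i hi
      have := (Finset.mem_filter.mp hi).2
      have := q_pow_pos F i
      omega
  · rw [if_neg hn.ne', map_atH_div F (toFrac F) hinj hn, sub_self]

/-- The degree in `θ` of `f ∈ A[t]`, multiplied by `q - 1`, is at most `N`. -/
def ThetaDegLE (N : ℕ) (f : F[X][X]) : Prop := ∀ j, (q F - 1) * (f.coeff j).natDegree ≤ N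

variable {F}

lemma ThetaDegLE.mono {N M : ℕ} (h : N ≤ M) {f : F[X][X]} (hf : ThetaDegLE F N f) :
    ThetaDegLE F M f := fun j => (hf j).trans h

omit [Fintype F] in
lemma mul_natDegree_sum_le {ι : Type*} (t : Finset ι) (f : ι → F[X]) (c N : ℕ)
    (h : ∀ i ∈ t, c * (f i).natDegree ≤ N) : c * (∑ i ∈ t, f i).natDegree ≤ N := by
  rcases Nat.eq_zero_or_pos c with rfl | hc
  · simp
  · rw [mul_comm, ← Nat.le_div_iff_mul_le hc]
    refine natDegree_sum_le_of_forall_le _ _ fun i hi => ?_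
    rw [Nat.le_div_iff_mul_le hc, mul_comm]
    exact h i hi

lemma ThetaDegLE.sum {ι : Type*} {t : Finset ι} {f : ι → F[X][X]} {N : ℕ}
    (h : ∀ i ∈ t, ThetaDegLE F N (f i)) : ThetaDegLE F N (∑ i ∈ t, f i) := by
  intro j
  rw [finsetSum_coeff]
  exact mul_natDegree_sum_le _ _ _ _ fun i hi => h i hi j

lemma ThetaDegLE.mul {N M : ℕ} {f g : F[X][X]} (hf : ThetaDegLE F N f)
    (hg : ThetaDegLE F M g) : ThetaDegLE F (N + M) (f * g) := by
  intro j
  rw [coeff_mul]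
  refine mul_natDegree_sum_le _ _ _ _ fun x _ => ?_
  calc _ ≤ (q F - 1) * ((f.coeff x.1).natDegree + (g.coeff x.2).natDegree) :=
        Nat.mul_le_mul_left _ natDegree_mul_le
    _ ≤ N + M := by rw [mul_add]; exact add_le_add (hf _) (hg _)

lemma thetaDegLE_substT (a : F[X]) : ThetaDegLE F 0 (substT F a) := by
  intro j
  simp [substT]

lemma thetaDegLE_atF (i : ℕ) : ThetaDegLE F (q F * q F ^ i) (atF F i) := by
  have key : ∀ m, ThetaDegLE F (q F * q F ^ m)
      (∏ j ∈ Finset.Icc 1 m, (X ^ (q F) ^ i - C (X ^ (q F) ^ j))) := by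
    intro m
    induction m with
    | zero =>
      intro j
      by_cases hj : j = 0 <;> simp [coeff_one, hj]
    | succ m ih =>
      rw [Finset.prod_Icc_succ_top (by omega)]
      have h1 : ThetaDegLE F ((q F - 1) * q F ^ (m + 1))
          (X ^ (q F) ^ i - C (X ^ (q F) ^ (m + 1))) := by
        intro j
        refine Nat.mul_le_mul_left _ ?_
        rw [coeff_sub, coeff_X_pow, coeff_C]
        refine (natDegree_sub_le _ _).trans (max_le ?_ ?_)
        · split_ifs <;> simp
        · split_ifs <;> simp
      refine (ih.mul h1).mono ?_
      obtain ⟨c, hc⟩ := Nat.exists_eq_add_of_le (one_lt_q F).le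
      rw [hc, Nat.add_sub_cancel_left, pow_succ]
      ring_nf
      rfl
  exact key i

lemma thetaDegLE_atH (n : ℕ) : ThetaDegLE F (n * q F) (atH F n) := by
  induction n using Nat.strong_induction_on with
  | _ n ih =>
    rcases Nat.eq_zero_or_pos n with rfl | hn
    · intro j
      by_cases hj : j = 0 <;> simp [coeff_one, hj]
    · rw [atH_of_pos F hn]
      refine ThetaDegLE.sum fun i hi => ?_
      have hi' := (Finset.mem_filter.mp hi).2
      have := q_pow_pos F i
      refine (((thetaDegLE_substT _).mul (thetaDegLE_atF i)).mul (ih _ (by omega))).mono ?_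
      rw [zero_add, mul_comm (q F), ← add_mul, Nat.add_sub_cancel' hi']

end AndersonThakur

/-! ### Carlitz polynomials and power sums -/

section PowerSums

variable (F : Type*) [Field F] [Fintype F]

/-- The embedding of `A` into `k`. -/
abbrev toRat : F[X] →ₐ[F] RatFunc F := IsScalarTower.toAlgHom F F[X] (RatFunc F)

omit [Fintype F] in
lemma toRat_injective : Function.Injective (toRat F) := IsFractionRing.injective F[X] (RatFunc F)

omit [Fintype F] in
lemma toRat_ne_zero {a : F[X]} (ha : a ≠ 0) : toRat F a ≠ 0 :=
  (map_ne_zero_iff _ (toRat_injective F)).mpr ha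

/-- The coefficient `1 / (D_i L_{d-i}^(q^i))` of `z^(q^i)` in the Carlitz polynomial
`∏_{deg a < d} (z - a) / D_d`, extended by zero to `i > d`. -/
def carlitzCoeff (d i : ℕ) : RatFunc F :=
  if i ≤ d then (toRat F (D F i) * toRat F (L F (d - i)) ^ q F ^ i)⁻¹ else 0

/-- The `F`-linear map `z ↦ ∑_{i ≤ d} z^(q^i) / (D_i L_{d-i}^(q^i))` on `k`. -/
def carlitzMap (d : ℕ) : RatFunc F →ₗ[F] RatFunc F :=
  ∑ i ∈ Finset.range (d + 1), carlitzCoeff F d i • (powHom F (RatFunc F) i).toLinearMap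

lemma carlitzMap_apply (d : ℕ) (z : RatFunc F) :
    carlitzMap F d z = ∑ i ∈ Finset.range (d + 1), carlitzCoeff F d i * z ^ q F ^ i := by
  simp [carlitzMap, LinearMap.sum_apply]

lemma toRat_bracket (e : ℕ) :
    toRat F (bracket F e) = toRat F X ^ q F ^ e - toRat F X := by
  simp [bracket]

lemma carlitzCoeff_succ (d i : ℕ) :
    carlitzCoeff F (d + 1) (i + 1) * toRat F (bracket F (i + 1)) = carlitzCoeff F d i ^ q F := by
  have hb := toRat_ne_zero F (bracket_ne_zero F (Nat.succ_ne_zero i))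
  unfold carlitzCoeff
  by_cases h : i ≤ d
  · rw [if_pos h, if_pos (by omega), D_succ, map_mul, map_pow, Nat.add_sub_add_right, inv_pow,
      mul_pow, ← pow_mul, ← pow_succ, mul_assoc, mul_inv, mul_comm, mul_inv_cancel_left₀ hb]
  · rw [if_neg h, if_neg (by omega), zero_mul, zero_pow (q_pos F).ne']

/-- For `i ≤ d`, the factor `θ^(q^(d+1)) - θ^(q^i)` removes the last factor of
`L_{d+1-i}^(q^i)`. -/
lemma carlitzCoeff_mul_sub {d i : ℕ} (h : i ≤ d) :
    carlitzCoeff F (d + 1) i * (toRat F X ^ q F ^ (d + 1) - toRat F X ^ q F ^ i) =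
      - carlitzCoeff F d i := by
  unfold carlitzCoeff
  rw [if_pos h, if_pos (by omega), Nat.succ_sub h, L_succ, map_mul, mul_pow, map_sub, map_pow,
    sub_pow_q_pow, ← pow_mul, ← pow_add, show d - i + 1 + i = d + 1 by omega]
  have h1 : toRat F X ^ q F ^ i - toRat F X ^ q F ^ (d + 1) ≠ 0 := by
    have := toRat_ne_zero F (X_pow_sub_X_pow_ne_zero F (a := q F ^ i) (b := q F ^ (d + 1))
      ((q_pow_injective F).ne (by omega)))
    simpa using this
  have h2 := toRat_ne_zero F (D_ne_zero F i)
  have h3 := pow_ne_zero (q F ^ i) (toRat_ne_zero F (L_ne_zero F (d - i)))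
  field_simp
  ring

/-- The functional equation of the Carlitz polynomials. -/
lemma carlitzMap_X_mul (d : ℕ) (z : RatFunc F) :
    carlitzMap F (d + 1) (toRat F X * z) =
      toRat F X * carlitzMap F (d + 1) z + carlitzMap F d z ^ q F := by
  rw [carlitzMap_apply, carlitzMap_apply, carlitzMap_apply, sum_pow_q, Finset.mul_sum,
    ← sub_eq_iff_eq_add', ← Finset.sum_sub_distrib, Finset.sum_range_succ']
  simp only [pow_zero, pow_one]
  rw [show ∀ a b : RatFunc F, a * (toRat F X * b) - toRat F X * (a * b) = 0 by intros; ring,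
    add_zero]
  refine Finset.sum_congr rfl fun i _ => ?_
  rw [mul_pow, mul_pow (carlitzCoeff F d i), ← carlitzCoeff_succ, toRat_bracket, ← pow_mul,
    ← pow_succ]
  ring

/-- The vanishing at `1`: the Carlitz logarithm `∑ z^(q^i) / L_i` is a right inverse of the
Carlitz exponential `∑ z^(q^i) / D_i`. -/
lemma carlitzMap_one (d : ℕ) : carlitzMap F d 1 = if d = 0 then 1 else 0 := by
  have h0 : carlitzMap F 0 1 = 1 := by simp [carlitzMap_apply, carlitzCoeff]
  -- In the `i`-th term, `θ^(q^(d+1)) - θ` is split at `θ^(q^i)`.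
  have key : ∀ d, toRat F (bracket F (d + 1)) * carlitzMap F (d + 1) 1 =
      carlitzMap F d 1 ^ q F - carlitzMap F d 1 := by
    intro d
    simp only [carlitzMap_apply, one_pow, mul_one]
    rw [sum_pow_q, Finset.mul_sum]
    have hsplit : ∀ i ∈ Finset.range (d + 1 + 1),
        toRat F (bracket F (d + 1)) * carlitzCoeff F (d + 1) i =
          carlitzCoeff F (d + 1) i * toRat F (bracket F i) +
          carlitzCoeff F (d + 1) i * (toRat F X ^ q F ^ (d + 1) - toRat F X ^ q F ^ i) := by
      intro i _
      rw [toRat_bracket, toRat_bracket]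
      ring
    rw [Finset.sum_congr rfl hsplit, Finset.sum_add_distrib, Finset.sum_range_succ',
      Finset.sum_range_succ _ (d + 1), sub_self, mul_zero, add_zero, sub_eq_add_neg,
      ← Finset.sum_neg_distrib]
    congr 1
    · rw [Finset.sum_congr rfl fun i _ => carlitzCoeff_succ F d i]
      simp [bracket]
    · refine Finset.sum_congr rfl fun i hi => carlitzCoeff_mul_sub F ?_
      simp at hi
      omega
  induction d with
  | zero => simpa using h0
  | succ d ih =>
    have hb := toRat_ne_zero F (bracket_ne_zero F (Nat.succ_ne_zero d))
    have := key d
    rw [ih] at this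
    rw [if_neg (Nat.succ_ne_zero d)]
    refine (mul_eq_zero.mp (this.trans ?_)).resolve_left hb
    split_ifs
    · simp
    · simp [(q_pos F).ne']

lemma carlitzMap_X_pow {d m : ℕ} (h : m ≤ d) :
    carlitzMap F d (toRat F X ^ m) = if m = d then 1 else 0 := by
  induction m generalizing d with
  | zero => rw [pow_zero, carlitzMap_one]; simp only [eq_comm]
  | succ m ih =>
    obtain ⟨d, rfl⟩ : ∃ e, d = e + 1 := ⟨d - 1, by omega⟩
    rw [pow_succ', carlitzMap_X_mul, ih (by omega), ih (by omega), if_neg (by omega)]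
    by_cases hm : m = d
    · simp [hm]
    · simp [hm, (q_pos F).ne']

lemma carlitzMap_monic {a : F[X]} (ha : a.Monic) : carlitzMap F a.natDegree (toRat F a) = 1 := by
  conv_lhs => arg 2; rw [ha.as_sum]
  have h : ∀ i ∈ Finset.range a.natDegree,
      carlitzMap F a.natDegree (toRat F (C (a.coeff i) * X ^ i)) = 0 := by
    intro i hi
    rw [← smul_eq_C_mul, map_smul, map_smul, map_pow,
      carlitzMap_X_pow F (Finset.mem_range.mp hi).le, if_neg (Finset.mem_range.mp hi).ne, smul_zero]
  rw [map_add, map_sum, map_add, map_sum, map_pow, Finset.sum_eq_zero h, add_zero,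
    carlitzMap_X_pow F le_rfl, if_pos rfl]

/-- The monic polynomials of degree `d`. -/
def monics (d : ℕ) : Finset F[X] :=
  Finset.univ.map ⟨fun c : Fin d → F => X ^ d + ∑ i : Fin d, C (c i) * X ^ (i : ℕ), by
    intro c c' h
    funext i
    have := congrArg (fun p : F[X] => p.coeff i) (add_left_cancel h)
    simpa [finsetSum_coeff, coeff_C_mul, coeff_X_pow, Fin.val_inj] using this⟩

lemma card_monics (d : ℕ) : (monics F d).card = q F ^ d := by
  simp [monics, q]

variable {F}

lemma mem_monics {d : ℕ} {a : F[X]} : a ∈ monics F d ↔ a.Monic ∧ a.natDegree = d := by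
  simp only [monics, Finset.mem_map, Finset.mem_univ, true_and]
  constructor
  · rintro ⟨c, rfl⟩
    have hlt : (∑ i : Fin d, C (c i) * X ^ (i : ℕ)).degree < (d : WithBot ℕ) :=
      (Polynomial.degree_sum_fin_lt c)
    refine ⟨monic_X_pow_add hlt, natDegree_eq_of_degree_eq_some (?_ : (X ^ d + _).degree = _)⟩
    rw [degree_add_eq_left_of_degree_lt (by rwa [degree_X_pow]), degree_X_pow]
  · rintro ⟨ha, rfl⟩
    refine ⟨fun i => a.coeff i, ?_⟩
    conv_rhs => rw [ha.as_sum]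
    rw [Finset.sum_range]
    rfl

variable (F)

/-- The polynomial `1 - ∑_{i ≤ d} z^(q^i) / (D_i L_{d-i}^(q^i))`, whose roots are the monic
polynomials of degree `d`. -/
def carlitzPoly (d : ℕ) : (RatFunc F)[X] :=
  1 - ∑ i ∈ Finset.range (d + 1), C (carlitzCoeff F d i) * X ^ q F ^ i

lemma eval_carlitzPoly {d : ℕ} {a : F[X]} (ha : a ∈ monics F d) :
    (carlitzPoly F d).eval (toRat F a) = 0 := by
  obtain ⟨hm, rfl⟩ := mem_monics.mp ha
  have := carlitzMap_monic F hm
  rw [carlitzMap_apply] at this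
  simp [carlitzPoly, eval_finsetSum, ← this]

lemma natDegree_carlitzPoly_le (d : ℕ) : (carlitzPoly F d).natDegree ≤ q F ^ d := by
  refine (natDegree_sub_le _ _).trans (max_le (by simp) ?_)
  refine natDegree_sum_le_of_forall_le _ _ fun i hi => (natDegree_C_mul_X_pow_le _ _).trans ?_
  exact Nat.pow_le_pow_right (q_pos F) (by simp at hi; omega)

lemma carlitzPoly_eq_prod (d : ℕ) : carlitzPoly F d =
    C (carlitzPoly F d).leadingCoeff * ∏ a ∈ monics F d, (X - C (toRat F a)) := by
  have hm : (∏ a ∈ monics F d, (X - C (toRat F a))).Monic := monic_prod_X_sub_C _ _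
  refine eq_leadingCoeff_mul_of_monic_of_dvd_of_natDegree_le hm ?_ ?_
  · refine Finset.prod_dvd_of_coprime (fun a _ b _ hab => ?_) fun a ha => ?_
    · exact pairwise_coprime_X_sub_C (toRat_injective F) hab
    · exact dvd_iff_isRoot.mpr (eval_carlitzPoly F ha)
  · rw [natDegree_finsetProd_X_sub_C_eq_card, card_monics]
    exact natDegree_carlitzPoly_le F d

lemma derivative_carlitzPoly (d : ℕ) :
    derivative (carlitzPoly F d) = - C (toRat F (L F d))⁻¹ := by
  rw [carlitzPoly, derivative_sub, derivative_one, zero_sub, derivative_sum,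
    Finset.sum_range_succ', Finset.sum_eq_zero]
  · simp [carlitzCoeff]
  · intro i _
    rw [derivative_C_mul_X_pow, pow_succ, Nat.cast_mul, q_cast_eq_zero, mul_zero, mul_zero, C_0,
      zero_mul]

/-- The power sum `S_d(s) = ∑ 1 / a^s` over the monic polynomials `a` of degree `d`. -/
def powerSum (d s : ℕ) : RatFunc F := ∑ a ∈ monics F d, (toRat F a ^ s)⁻¹

lemma X_sub_C_mul_geom {K : Type*} [Field K] {a : K} (ha : a ≠ 0) :
    ((X - C a : K[X]) : PowerSeries K) * PowerSeries.mk (fun n => (a ^ (n + 1))⁻¹) = -1 := by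
  ext n
  rw [Polynomial.coe_sub, Polynomial.coe_X, Polynomial.coe_C, sub_mul, map_sub,
    PowerSeries.coeff_C_mul, PowerSeries.coeff_mk]
  cases n with
  | zero => simp [ha]
  | succ n =>
    rw [PowerSeries.coeff_succ_X_mul, PowerSeries.coeff_mk, map_neg, PowerSeries.coeff_one,
      if_neg (Nat.succ_ne_zero n), neg_zero, sub_eq_zero]
    rw [pow_succ _ (n + 1), mul_inv_rev, mul_inv_cancel_left₀ ha]

/-- Logarithmic differentiation of `∏ (1 - z / a)` over the monic polynomials `a` of degree
`d`. -/
lemma carlitzPoly_mul_powerSum (d : ℕ) :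
    (carlitzPoly F d : PowerSeries (RatFunc F)) *
      PowerSeries.mk (fun n => powerSum F d (n + 1)) = PowerSeries.C (toRat F (L F d))⁻¹ := by
  classical
  have h1 : PowerSeries.mk (fun n => powerSum F d (n + 1)) =
      ∑ a ∈ monics F d, PowerSeries.mk fun n => (toRat F a ^ (n + 1))⁻¹ := by
    ext n
    simp [powerSum]
  have h2 := derivative_carlitzPoly F d
  rw [carlitzPoly_eq_prod, derivative_C_mul, derivative_prod_finset] at h2
  have h3 := congrArg Polynomial.coeToPowerSeries.ringHom h2
  simp only [map_neg, map_mul, map_sum] at h3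
  simp only [Polynomial.coeToPowerSeries.ringHom_apply, Polynomial.coe_C] at h3
  rw [h1, Finset.mul_sum, ← neg_inj, ← h3, Finset.mul_sum, ← Finset.sum_neg_distrib]
  refine Finset.sum_congr rfl fun a ha => ?_
  have ha0 : toRat F a ≠ 0 := toRat_ne_zero F (mem_monics.mp ha).1.ne_zero
  conv_lhs => rw [carlitzPoly_eq_prod, ← Finset.mul_prod_erase _ _ ha]
  have h4 := X_sub_C_mul_geom ha0
  simp only [Polynomial.coe_mul, Polynomial.coe_C, Polynomial.coe_one,
    derivative_sub, derivative_X, derivative_C, sub_zero, mul_one]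
  linear_combination (- PowerSeries.C (carlitzPoly F d).leadingCoeff *
    ((∏ a ∈ (monics F d).erase a, (X - C (toRat F a)) : (RatFunc F)[X]) :
      PowerSeries (RatFunc F))) * h4

lemma coe_carlitzPoly (d : ℕ) : (carlitzPoly F d : PowerSeries (RatFunc F)) =
    1 - PowerSeries.mk (fun n => ∑ i ∈ (Finset.range (n + 1)).filter (fun i => q F ^ i = n),
      carlitzCoeff F d i) := by
  ext n
  rw [carlitzPoly, Polynomial.coe_sub, Polynomial.coe_one, map_sub, map_sub, PowerSeries.coeff_mk,
    Polynomial.coeff_coe, finsetSum_coeff]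
  congr 1
  simp only [coeff_C_mul, coeff_X_pow, mul_ite, mul_one, mul_zero, Finset.sum_filter, eq_comm]
  refine Finset.sum_congr_of_eq_on_inter ?_ ?_ ?_
  · intro i hi hi'
    rw [if_neg]
    rintro rfl
    exact hi' (Finset.mem_range.mpr ((Nat.lt_pow_self (one_lt_q F)).trans (Nat.lt_succ_self _)))
  · intro i hi hi'
    have h0 : carlitzCoeff F d i = 0 := if_neg (by simpa using hi')
    rw [h0, ite_self]
  · intros; rfl

/-- The recursion for the power sums. -/
lemma powerSum_succ (d n : ℕ) : powerSum F d (n + 1) =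
    (if n = 0 then (toRat F (L F d))⁻¹ else 0) +
      ∑ i ∈ (Finset.range (n + 1)).filter (fun i => q F ^ i ≤ n),
        carlitzCoeff F d i * powerSum F d (n - q F ^ i + 1) := by
  have h := congrArg (PowerSeries.coeff n) (carlitzPoly_mul_powerSum F d)
  rw [coe_carlitzPoly, sub_mul, one_mul, map_sub, coeff_mk_pow_mul (one_lt_q F),
    PowerSeries.coeff_mk, PowerSeries.coeff_C] at h
  rw [← h, sub_add_cancel]

end PowerSums

/-! ### The power sums as twisted values of the Anderson–Thakur polynomials -/

section Specialization

variable (F : Type*) [Field F] [Fintype F]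

/-- The homomorphism `A[t] → A` that sends `f = ∑ u_j t^j` to `∑ u_j^(q^d) θ^j`, the value at
`t = θ` of the `d`-fold twist of `f`. -/
def twistEval (d : ℕ) : F[X][X] →+* F[X] :=
  eval₂RingHom (powHom F F[X] d : F[X] →+* F[X]) X

lemma twistEval_eq_sum (d : ℕ) (f : F[X][X]) :
    twistEval F d f = ∑ j ∈ Finset.range (f.natDegree + 1), f.coeff j ^ q F ^ d * X ^ j := by
  rw [twistEval, coe_eval₂RingHom, eval₂_eq_sum_range]
  simp

lemma twistEval_substT (d : ℕ) (a : F[X]) : twistEval F d (substT F a) = a := by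
  rw [twistEval, coe_eval₂RingHom, substT, eval₂_map]
  have : ((powHom F F[X] d : F[X] →+* F[X]).comp C) = C := by
    ext1 c
    exact (powHom F F[X] d).commutes c
  rw [this, eval₂_C_X]

/-- For `i > d` both sides vanish: the factor `t^(q^i) - θ^(q^j)` of `F_i` with `j = i - d` is
killed. For `i ≤ d` this is `F_i ↦ (L_d / L_{d-i})^(q^i)`. -/
lemma twistEval_atF (d i : ℕ) :
    toRat F (twistEval F d (atF F i)) / toRat F (D F i) =
      carlitzCoeff F d i * toRat F (L F d) ^ q F ^ i := by
  have h1 : twistEval F d (atF F i) =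
      ∏ j ∈ Finset.Icc 1 i, (X ^ q F ^ i - X ^ q F ^ (j + d)) := by
    rw [twistEval, atF, map_prod]
    refine Finset.prod_congr rfl fun j _ => ?_
    simp [-map_pow, ← pow_mul, pow_add]
  by_cases h : i ≤ d
  · have h2 : L F d ^ q F ^ i = L F (d - i) ^ q F ^ i * twistEval F d (atF F i) := by
      obtain ⟨e, rfl⟩ := Nat.exists_eq_add_of_le' h
      rw [h1, Nat.add_sub_cancel]
      clear h h1
      have key : ∀ m, L F (e + m) ^ q F ^ i =
          L F e ^ q F ^ i * ∏ j ∈ Finset.Icc 1 m, (X ^ q F ^ i - X ^ q F ^ (j + (e + i))) := by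
        intro m
        induction m with
        | zero => simp
        | succ m ih =>
          rw [← add_assoc, L_succ, mul_pow, ih, Finset.prod_Icc_succ_top (by omega), sub_pow_q_pow,
            ← pow_mul, ← pow_add, show e + m + 1 + i = m + 1 + (e + i) by omega, mul_assoc]
      exact key i
    have h3 := toRat_ne_zero F (L_ne_zero F (d - i))
    have h4 := toRat_ne_zero F (D_ne_zero F i)
    rw [carlitzCoeff, if_pos h, ← map_pow (toRat F) (L F d), h2, map_mul, map_pow]
    field_simp
  · rw [carlitzCoeff, if_neg h, h1, Finset.prod_eq_zero (i := i - d), map_zero, zero_div, zero_mul]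
    · simp; omega
    · rw [Nat.sub_add_cancel (by omega), sub_self]

/-- **Anderson–Thakur**: `Γ_{n+1} S_d(n+1) L_d^{n+1}` is the value at `t = θ` of the `d`-fold twist
of `H_n`. -/
theorem powerSum_eq_twistEval (d n : ℕ) :
    toRat F (gammaSucc F n) * powerSum F d (n + 1) * toRat F (L F d) ^ (n + 1) =
      toRat F (twistEval F d (atH F n)) := by
  have hL := toRat_ne_zero F (L_ne_zero F d)
  have key : toRat F (twistEval F d (atH F n)) / toRat F (gammaSucc F n) =
      powerSum F d (n + 1) * toRat F (L F d) ^ (n + 1) := by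
    induction n using Nat.strong_induction_on with
    | _ n ih =>
      rcases Nat.eq_zero_or_pos n with rfl | hn
      · rw [powerSum_succ, Finset.sum_eq_zero]
        · simpa using (inv_mul_cancel₀ hL).symm
        · intro i hi
          have := (Finset.mem_filter.mp hi).2
          have := q_pow_pos F i
          omega
      · have h := map_atH_div F ((toRat F : F[X] →+* RatFunc F).comp (twistEval F d))
          (fun a ha => by simpa [twistEval_substT] using ha) hn
        simp only [RingHom.comp_apply, twistEval_substT, RingHom.coe_coe] at h
        rw [h, powerSum_succ, if_neg hn.ne', zero_add, Finset.sum_mul]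
        refine Finset.sum_congr rfl fun i hi => ?_
        have hi' := (Finset.mem_filter.mp hi).2
        have := q_pow_pos F i
        have hs : n + 1 = q F ^ i + (n - q F ^ i + 1) := by omega
        rw [ih _ (by omega), twistEval_atF, hs, pow_add _ (q F ^ i)]
        ring
  rw [mul_assoc, ← key, mul_div_cancel₀ _ (toRat_ne_zero F (gammaSucc_ne_zero F n))]

end Specialization

/-! ### Words and blocks -/

section WordCombinatorics

variable {r : ℕ}

lemma Word.dep_le (hr : 0 < r) (w : Word r) : w.dep ≤ r := by
  have := Finset.card_filter_le (Finset.univ : Finset (Fin (r - 1))) (fun i => w i = Sep.comma)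
  rw [Finset.card_univ, Fintype.card_fin] at this
  unfold Word.dep
  omega

/-- The entry to the left of the symbol `k`. -/
def leftEntry (k : Fin (r - 1)) : Fin r := ⟨k, by omega⟩

/-- The entry to the right of the symbol `k`. -/
def rightEntry (k : Fin (r - 1)) : Fin r := ⟨k + 1, by omega⟩

lemma Word.block_mono (w : Word r) : Monotone w.block := by
  intro a b hab
  refine Finset.card_le_card fun i hi => ?_
  simp only [Finset.mem_filter, Finset.mem_univ, true_and] at hi ⊢
  exact ⟨hi.1.trans_le hab, hi.2⟩

lemma Word.block_rightEntry (w : Word r) (k : Fin (r - 1)) :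
    w.block (rightEntry k) = w.block (leftEntry k) + if w k = Sep.comma then 1 else 0 := by
  have h : (Finset.univ.filter fun i : Fin (r - 1) =>
        (i : ℕ) < rightEntry k ∧ w i = Sep.comma) =
      (Finset.univ.filter fun i : Fin (r - 1) => (i : ℕ) < leftEntry k ∧ w i = Sep.comma) ∪
        if w k = Sep.comma then {k} else ∅ := by
    ext i
    have hik : (i : ℕ) < rightEntry k ↔ (i : ℕ) < leftEntry k ∨ i = k := by
      rw [← Fin.val_inj]
      exact Nat.lt_succ_iff_lt_or_eq
    split_ifs with hk
    · simp only [Finset.mem_filter, Finset.mem_univ, true_and, Finset.mem_union,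
        Finset.mem_singleton, hik]
      constructor
      · rintro ⟨h1 | h1, h2⟩
        · exact Or.inl ⟨h1, h2⟩
        · exact Or.inr h1
      · rintro (⟨h1, h2⟩ | rfl)
        · exact ⟨Or.inl h1, h2⟩
        · exact ⟨Or.inr rfl, hk⟩
    · simp only [Finset.mem_filter, Finset.mem_univ, true_and, Finset.union_empty, hik]
      constructor
      · rintro ⟨h1 | rfl, h2⟩
        · exact ⟨h1, h2⟩
        · exact absurd h2 hk
      · rintro ⟨h1, h2⟩
        exact ⟨Or.inl h1, h2⟩
  rw [Word.block, h, Finset.card_union_of_disjoint]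
  · split_ifs <;> simp [Word.block]
  · split_ifs <;> simp [leftEntry]

lemma Word.block_lt_dep (w : Word r) (j : Fin r) : w.block j < w.dep := by
  refine Nat.lt_succ_of_le (Finset.card_le_card fun i hi => ?_)
  simp only [Finset.mem_filter, Finset.mem_univ, true_and] at hi ⊢
  exact hi.2

/-- The block that contains a given entry, as a position in the resulting tuple. -/
def Word.blockFin (w : Word r) (j : Fin r) : Fin w.dep := ⟨w.block j, w.block_lt_dep j⟩

/-- The block number starts at `0` and increases by at most `1` from an entry to the next, so it
takes all intermediate values. -/
lemma Word.exists_block_eq (w : Word r) (n : ℕ) (hn : n < r) (m : ℕ) (hm : m ≤ w.block ⟨n, hn⟩) :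
    ∃ j, w.block j = m := by
  induction n with
  | zero =>
    refine ⟨⟨0, hn⟩, ?_⟩
    have : w.block ⟨0, hn⟩ = 0 := by simp [Word.block]
    omega
  | succ n ih =>
    have h := w.block_rightEntry ⟨n, by omega⟩
    change w.block ⟨n + 1, hn⟩ = w.block ⟨n, by omega⟩ + _ at h
    rcases Nat.lt_or_ge (w.block ⟨n, by omega⟩) m with h1 | h1
    · refine ⟨⟨n + 1, hn⟩, le_antisymm ?_ hm⟩
      split_ifs at h <;> omega
    · exact ih (by omega) h1

lemma Word.blockFin_surjective (hr : 0 < r) (w : Word r) : Function.Surjective w.blockFin := by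
  intro m
  have h : w.block ⟨r - 1, by omega⟩ + 1 = w.dep := by
    rw [Word.dep, Word.block]
    congr 3
    ext i
    simp
  obtain ⟨j, hj⟩ := w.exists_block_eq (r - 1) (by omega) m (by have := m.2; omega)
  exact ⟨j, Fin.ext hj⟩

lemma Word.filter_block_eq (w : Word r) (m : Fin w.dep) :
    (Finset.univ.filter fun j => w.block j = (m : ℕ)) =
      Finset.univ.filter fun j => w.blockFin j = m := by
  simp [Word.blockFin, Fin.ext_iff]

lemma Word.sum_addTuple (w : Word r) (s : Fin r → ℕ) : ∑ m, w.addTuple s m = ∑ i, s i := by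
  simp only [Word.addTuple, Word.filter_block_eq]
  exact Finset.sum_fiberwise _ _ _

lemma Word.addTuple_pos (hr : 0 < r) (w : Word r) {s : Fin r → ℕ} (hs : ∀ i, 0 < s i)
    (m : Fin w.dep) : 0 < w.addTuple s m := by
  obtain ⟨j, rfl⟩ := w.blockFin_surjective hr m
  exact (hs j).trans_le (Finset.single_le_sum (f := s) (fun _ _ => Nat.zero_le _)
    (Finset.mem_filter.mpr ⟨Finset.mem_univ _, rfl⟩))

/-- The condition on an antitone tuple to be constant on the blocks of `w`. -/
def Word.Compatible (w : Word r) (i : Fin r → ℕ) : Prop :=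
  ∀ k, w k = Sep.plus → i (leftEntry k) = i (rightEntry k)

lemma Sep.ne_comma_iff {x : Sep} : x ≠ Sep.comma ↔ x = Sep.plus := by
  cases x <;> simp

lemma Word.Compatible.eq_of_block_eq {w : Word r} {i : Fin r → ℕ} (hi : w.Compatible i)
    {a b : Fin r} (hab : w.block a = w.block b) : i a = i b := by
  wlog h : a ≤ b generalizing a b
  · exact (this hab.symm (le_of_not_ge h)).symm
  obtain ⟨n, hn⟩ := Nat.exists_eq_add_of_le (Fin.le_def.mp h)
  induction n generalizing b with
  | zero => exact congrArg i (Fin.ext (by omega))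
  | succ n ih =>
    have hb := b.2
    let k : Fin (r - 1) := ⟨a + n, by omega⟩
    have hbk : b = rightEntry k := Fin.ext (by simp [rightEntry, k]; omega)
    have hak : a ≤ leftEntry k := Fin.le_def.mpr (by simp [leftEntry, k])
    have h1 := w.block_mono hak
    have h2 := w.block_rightEntry k
    rw [← hbk, ← hab] at h2
    have h3 : w k = Sep.plus := by
      rw [← Sep.ne_comma_iff]
      intro h3
      rw [if_pos h3] at h2
      omega
    rw [hbk, ← hi k h3]
    refine ih ?_ hak (by simp [leftEntry, k])
    rw [h3] at h2
    simpa using h2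

lemma Word.compatible_comp_blockFin (w : Word r) (i : Fin w.dep → ℕ) :
    w.Compatible (i ∘ w.blockFin) := by
  intro k hk
  refine congrArg i (Fin.ext ?_)
  have := w.block_rightEntry k
  simpa [hk, Word.blockFin] using this.symm

/-- Compatible antitone tuples factor through the blocks. -/
lemma Word.exists_comp_blockFin (hr : 0 < r) (w : Word r) {i : Fin r → ℕ} (ha : Antitone i)
    (hi : w.Compatible i) : ∃ i' : Fin w.dep → ℕ, Antitone i' ∧ i' ∘ w.blockFin = i := by
  have hs := w.blockFin_surjective hr
  refine ⟨i ∘ Function.surjInv hs, fun m m' hm => ?_, ?_⟩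
  · rcases hm.eq_or_lt with rfl | hlt
    · rfl
    · refine ha (le_of_not_gt fun h => ?_)
      have h1 := w.block_mono h.le
      have h2 := congrArg Fin.val (Function.surjInv_eq hs m)
      have h3 := congrArg Fin.val (Function.surjInv_eq hs m')
      simp only [Word.blockFin] at h2 h3
      have := Fin.lt_def.mp hlt
      omega
  · funext j
    exact hi.eq_of_block_eq (congrArg Fin.val (Function.surjInv_eq hs (w.blockFin j)))

lemma strictAnti_iff {i : Fin r → ℕ} :
    StrictAnti i ↔ Antitone i ∧ ∀ k : Fin (r - 1), i (leftEntry k) ≠ i (rightEntry k) := by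
  constructor
  · intro h
    exact ⟨h.antitone, fun k => (h (Fin.lt_def.mpr (by simp [leftEntry, rightEntry]))).ne'⟩
  · rintro ⟨ha, h⟩ a b hab
    have hab' := Fin.lt_def.mp hab
    have hb := b.2
    let k : Fin (r - 1) := ⟨a, by omega⟩
    have h1 : i b ≤ i (rightEntry k) := ha (Fin.le_def.mpr (by simp [rightEntry, k]; omega))
    have h2 : i (rightEntry k) ≤ i (leftEntry k) :=
      ha (Fin.le_def.mpr (by simp [leftEntry, rightEntry]))
    exact h1.trans_lt (lt_of_le_of_ne h2 (h k).symm)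

open Classical in
/-- Inclusion–exclusion over the positions where an antitone tuple is constant. -/
lemma sum_word_sign {R : Type*} [CommRing R] {i : Fin r → ℕ} (ha : Antitone i) :
    ∑ w : Word r, (-1 : R) ^ (r - 1) * (-1) ^ (w.dep - 1) * (if w.Compatible i then 1 else 0) =
      if StrictAnti i then 1 else 0 := by
  let c : Fin (r - 1) → Sep → R := fun k x =>
    if x = Sep.comma then 1 else if i (leftEntry k) = i (rightEntry k) then -1 else 0
  have h1 : ∀ w : Word r, (-1 : R) ^ (r - 1) * (-1) ^ (w.dep - 1) *
      (if w.Compatible i then 1 else 0) = ∏ k, c k (w k) := by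
    intro w
    have e1 : (-1 : R) ^ (r - 1) = ∏ _k : Fin (r - 1), (-1 : R) := by simp
    have e2 : (-1 : R) ^ (w.dep - 1) =
        ∏ k : Fin (r - 1), if w k = Sep.comma then (-1 : R) else 1 := by
      rw [Finset.prod_ite]
      simp [Word.dep]
    have e3 : (if w.Compatible i then 1 else 0 : R) = ∏ k : Fin (r - 1),
        if w k = Sep.plus → i (leftEntry k) = i (rightEntry k) then (1 : R) else 0 := by
      rw [Finset.prod_ite_zero]
      simp only [Word.Compatible, Finset.mem_univ, true_imp_iff, Finset.prod_const_one]
      congr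
    rw [e1, e2, e3, ← Finset.prod_mul_distrib, ← Finset.prod_mul_distrib]
    refine Finset.prod_congr rfl fun k _ => ?_
    cases hk : w k <;> simp [c]
  rw [Finset.sum_congr rfl fun w _ => h1 w, ← Fintype.piFinset_univ, ← Finset.prod_univ_sum]
  have h2 : ∀ k, ∑ x : Sep, c k x =
      if i (leftEntry k) ≠ i (rightEntry k) then (1 : R) else 0 := by
    intro k
    have : (Finset.univ : Finset Sep) = {Sep.comma, Sep.plus} := rfl
    rw [this, Finset.sum_pair (by decide)]
    by_cases h : i (leftEntry k) = i (rightEntry k) <;> simp [c, h]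
  rw [Finset.prod_congr rfl fun k _ => h2 k, Finset.prod_ite_zero]
  simp [strictAnti_iff, ha]

end WordCombinatorics

/-! ### Strict sums as alternating sums of star sums -/

section StarSums

variable {r : ℕ} {K : Type*} [CommRing K] [TopologicalSpace K]

lemma blockFin_comp_injective (hr : 0 < r) (w : Word r) :
    Function.Injective fun i : {i : Fin w.dep → ℕ // Antitone i} => i.1 ∘ w.blockFin :=
  fun _ _ h => Subtype.ext ((w.blockFin_surjective hr).injective_comp_right h)

open Classical in
/-- A star sum over the tuples that result from a word is a sum over the antitone `r`-tuples that
are constant on its blocks. -/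
lemma hasSum_comp_blockFin_iff (hr : 0 < r) (w : Word r) (g : (Fin r → ℕ) → K) (a : K) :
    HasSum (fun i : {i : Fin w.dep → ℕ // Antitone i} => g (i.1 ∘ w.blockFin)) a ↔
      HasSum (fun i => if Antitone i ∧ w.Compatible i then g i else 0) a := by
  rw [← (blockFin_comp_injective hr w).hasSum_iff]
  · refine iff_of_eq (congrArg (fun f => HasSum f a) (funext fun i => ?_))
    have h1 : Antitone (i.1 ∘ w.blockFin) := i.2.comp_monotone fun _ _ h => w.block_mono h
    exact (if_pos ⟨h1, w.compatible_comp_blockFin _⟩).symm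
  · intro i hi
    refine if_neg fun h => hi ?_
    obtain ⟨i', h1, h2⟩ := w.exists_comp_blockFin hr h.1 h.2
    exact ⟨⟨i', h1⟩, h2⟩

/-- A sum over strictly decreasing tuples is an alternating sum of star sums over words. -/
lemma hasSum_strictAnti [IsTopologicalRing K] [T2Space K] (hr : 0 < r) (g : (Fin r → ℕ) → K)
    (hg : ∀ w : Word r,
      Summable fun i : {i : Fin w.dep → ℕ // Antitone i} => g (i.1 ∘ w.blockFin)) :
    HasSum (fun i : {i : Fin r → ℕ // StrictAnti i} => g i.1)
      (∑ w : Word r, (-1) ^ (r - 1) * (-1) ^ (w.dep - 1) *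
        ∑' i : {i : Fin w.dep → ℕ // Antitone i}, g (i.1 ∘ w.blockFin)) := by
  classical
  have h := hasSum_sum (s := Finset.univ) fun (w : Word r) _ =>
    (((hasSum_comp_blockFin_iff hr w g _).mp (hg w).hasSum).mul_left
      ((-1 : K) ^ (r - 1) * (-1) ^ (w.dep - 1)))
  have h2 : (fun i : Fin r → ℕ => ∑ w : Word r, (-1 : K) ^ (r - 1) * (-1) ^ (w.dep - 1) *
      (if Antitone i ∧ w.Compatible i then g i else 0)) =
      Set.indicator {i : Fin r → ℕ | StrictAnti i} g := by
    funext i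
    by_cases ha : Antitone i
    · have h3 : Set.indicator {i : Fin r → ℕ | StrictAnti i} g i =
          (if StrictAnti i then 1 else 0) * g i := by
        by_cases hs : StrictAnti i <;> simp [Set.indicator, hs]
      rw [h3, ← sum_word_sign ha, Finset.sum_mul]
      refine Finset.sum_congr rfl fun w _ => ?_
      by_cases hw : w.Compatible i <;> simp [ha, hw]
    · rw [Set.indicator_of_notMem (fun h : StrictAnti i => ha h.antitone)]
      exact Finset.sum_eq_zero fun w _ => by rw [if_neg fun h => ha h.1, mul_zero]
  rw [h2] at h
  exact hasSum_subtype_iff_indicator.mpr h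

end StarSums

/-! ### Convergence of the series -/

section Convergence

open WithZero

variable {F : Type*} [Field F] [Fintype F] [DecidableEq (RatFunc F)]

omit [Fintype F] in
lemma valuation_prod_le {ι : Type*} (t : Finset ι) (f : ι → RatFunc.CompletionAtInfty F)
    (e : ι → ℤ) (h : ∀ i ∈ t, Valued.v (f i) ≤ exp (e i)) :
    Valued.v (∏ i ∈ t, f i) ≤ exp (∑ i ∈ t, e i) := by
  classical
  induction t using Finset.induction_on with
  | empty => simp
  | insert i t hi ih =>
    rw [Finset.prod_insert hi, Finset.sum_insert hi, map_mul, exp_add]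
    exact mul_le_mul' (h i (Finset.mem_insert_self i t))
      (ih fun j hj => h j (Finset.mem_insert_of_mem hj))

omit [DecidableEq (RatFunc F)] in
lemma natDegree_L (i : ℕ) : (q F - 1) * (L F i).natDegree + q F = q F * q F ^ i := by
  obtain ⟨c, hc⟩ := Nat.exists_eq_add_of_le (one_lt_q F).le
  induction i with
  | zero => simp
  | succ i ih =>
    have h : (X - X ^ q F ^ (i + 1) : F[X]).natDegree = q F ^ (i + 1) := by
      rw [natDegree_sub_eq_right_of_natDegree_lt, natDegree_X_pow]
      rw [natDegree_X, natDegree_X_pow]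
      exact Nat.one_lt_pow (Nat.succ_ne_zero i) (one_lt_q F)
    have h0 := L_ne_zero F (i + 1)
    rw [L_succ] at h0 ⊢
    rw [natDegree_mul (left_ne_zero_of_mul h0) (right_ne_zero_of_mul h0), h, mul_add, add_right_comm,
      ih, hc, Nat.add_sub_cancel_left, pow_succ]
    ring

/-- The bound on the degree of the argument is the one that the Anderson–Thakur polynomials
satisfy; the degree of `L_i` outgrows it. -/
lemma valuation_star_factor_le {s i : ℕ} {z : F[X]}
    (hz : (q F - 1) * z.natDegree + q F ≤ s * q F) :
    Valued.v (toInfty F z ^ q F ^ i / toInfty F (L F i) ^ s) ≤ exp ((q F * s : ℕ) - (i : ℤ)) := by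
  rw [map_div₀, map_pow, map_pow, valuation_toInfty (L_ne_zero F i), div_eq_mul_inv]
  refine (mul_le_mul' (pow_le_pow_left' (valuation_toInfty_le z) _) le_rfl).trans ?_
  rw [← div_eq_mul_inv, ← exp_nsmul, ← exp_nsmul, ← exp_sub, exp_le_exp]
  have hL := natDegree_L (F := F) i
  have hi : (i : ℤ) ≤ ((q F ^ i : ℕ) : ℤ) := by exact_mod_cast (Nat.lt_pow_self (one_lt_q F)).le
  have hQ : (0 : ℤ) < ((q F ^ i : ℕ) : ℤ) := by exact_mod_cast q_pow_pos F i
  obtain ⟨c, hc⟩ := Nat.exists_eq_add_of_le (one_lt_q F).nat_succ_le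
  rw [show q F - 1 = c + 1 by omega] at hz hL
  zify at hz hL
  have hq : (q F : ℤ) = c + 2 := by rw [hc]; push_cast; ring
  push_cast at hi hQ ⊢
  simp only [nsmul_eq_mul, Nat.cast_pow]
  rw [hq] at hz hL hi hQ ⊢
  set Q : ℤ := ((c : ℤ) + 2) ^ i
  have hs : (0 : ℤ) ≤ s := by positivity
  have hc0 : (0 : ℤ) ≤ c := by positivity
  have hc1 : (0 : ℤ) < c + 1 := by positivity
  refine le_trans ?_ (sub_le_sub_left hi _)
  -- After multiplication by `q - 1 = c + 1`, the difference of the two sides is at least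
  -- `c (c + 2) s + q^i`.
  refine le_of_mul_le_mul_left ?_ hc1
  have h1 := mul_le_mul_of_nonneg_left hz hQ.le
  have h2 := congrArg (fun x : ℤ => (s : ℤ) * x) hL
  have h3 : 0 ≤ (c : ℤ) * s := mul_nonneg hc0 hs
  have h4 : 0 ≤ (c : ℤ) * (c * s) := mul_nonneg hc0 h3
  nlinarith

lemma finite_antitone_sum_le (d N : ℕ) :
    {i : {i : Fin d → ℕ // Antitone i} | ∑ m, i.1 m ≤ N}.Finite := by
  refine Set.Finite.of_finite_image (f := Subtype.val)
    ((Set.finite_Iic (fun _ : Fin d => N)).subset ?_) Subtype.val_injective.injOn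
  rintro _ ⟨i, hi, rfl⟩ m
  exact (Finset.single_le_sum (f := i.1) (fun _ _ => Nat.zero_le _) (Finset.mem_univ m)).trans hi

lemma summable_starTerm {d : ℕ} (s : Fin d → ℕ) (z : Fin d → F[X])
    (hz : ∀ m, (q F - 1) * (z m).natDegree + q F ≤ s m * q F) :
    Summable (starTerm F s fun m => toInfty F (z m)) := by
  refine summable_of_valuation_le _ (fun i => ∑ m, i.1 m) (∑ m, (q F * s m : ℕ))
    (finite_antitone_sum_le d) fun i => ?_
  rw [starTerm, ← Finset.prod_div_distrib]
  refine (valuation_prod_le _ _ _ fun m _ => valuation_star_factor_le (hz m)).trans_eq ?_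
  rw [Finset.sum_sub_distrib]
  push_cast
  rfl

omit [DecidableEq (RatFunc F)] in
lemma finite_natDegree_le (N : ℕ) : {a : F[X] | a.Monic ∧ a.natDegree ≤ N}.Finite := by
  refine ((Set.finite_Iic N).biUnion fun d _ => (monics F d).finite_toSet).subset ?_
  rintro a ⟨ha, hN⟩
  exact Set.mem_biUnion (Set.mem_Iic.mpr hN) (mem_monics.mpr ⟨ha, rfl⟩)

lemma summable_zetaTerm {r : ℕ} (s : Fin r → ℕ) (hs : ∀ i, 0 < s i) :
    Summable (zetaTerm F s) := by
  refine summable_of_valuation_le _ (fun a => ∑ m, (a.1 m).natDegree) 0 (fun N => ?_) fun a => ?_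
  · refine Set.Finite.of_finite_image (f := Subtype.val) ((Set.Finite.pi' (fun _ : Fin r =>
      finite_natDegree_le (F := F) N)).subset ?_) Subtype.val_injective.injOn
    rintro _ ⟨a, ha, rfl⟩ m
    exact ⟨a.2.1 m, (Finset.single_le_sum (f := fun m => (a.1 m).natDegree)
      (fun _ _ => Nat.zero_le _) (Finset.mem_univ m)).trans ha⟩
  · rw [zetaTerm, one_div, ← Finset.prod_inv_distrib]
    refine (valuation_prod_le _ _ (fun m => -((a.1 m).natDegree : ℤ)) fun m _ => ?_).trans_eq ?_
    · rw [map_inv₀, map_pow, valuation_toInfty (a.2.1 m).ne_zero, ← exp_nsmul, ← exp_neg,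
        exp_le_exp, neg_le_neg_iff, nsmul_eq_mul]
      exact le_mul_of_one_le_left (by positivity) (by exact_mod_cast hs m)
    · simp

end Convergence

/-! ### Multiple zeta values and polylogarithms -/

section Values

variable {F : Type*} [Field F] [Fintype F] [DecidableEq (RatFunc F)]

/-- The power sum `S_d(s)`, in `k_∞`. -/
def powerSumInfty (F : Type*) [Field F] [Fintype F] [DecidableEq (RatFunc F)] (d s : ℕ) :
    RatFunc.CompletionAtInfty F :=
  algebraMap (RatFunc F) _ (powerSum F d s)

lemma powerSumInfty_eq (d s : ℕ) :
    powerSumInfty F d s = ∑ a ∈ monics F d, (toInfty F a ^ s)⁻¹ := by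
  rw [powerSumInfty, powerSum, map_sum]
  refine Finset.sum_congr rfl fun a _ => ?_
  rw [map_inv₀, map_pow]
  rfl

lemma gamma_mul_powerSumInfty (d : ℕ) {s : ℕ} (hs : 0 < s) :
    toInfty F (gammaSucc F (s - 1)) * powerSumInfty F d s =
      ∑ j ∈ Finset.range ((atH F (s - 1)).natDegree + 1), toInfty F X ^ j *
        (toInfty F ((atH F (s - 1)).coeff j) ^ q F ^ d / toInfty F (L F d) ^ s) := by
  have h := congrArg (algebraMap (RatFunc F) (RatFunc.CompletionAtInfty F))
    (powerSum_eq_twistEval F d (s - 1))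
  rw [Nat.sub_add_cancel hs, map_mul, map_mul, map_pow] at h
  change toInfty F _ * powerSumInfty F d s * toInfty F _ ^ s = toInfty F _ at h
  have hL := pow_ne_zero s (toInfty_ne_zero (L_ne_zero F d))
  rw [← mul_div_cancel_right₀ (_ * powerSumInfty F d s) hL, h, twistEval_eq_sum, map_sum,
    Finset.sum_div]
  refine Finset.sum_congr rfl fun j _ => ?_
  rw [map_mul, map_pow, map_pow]
  ring

/-- The multiple zeta value, summed over the degrees of the monic polynomials. -/
lemma hasSum_zetaA {r : ℕ} (s : Fin r → ℕ) (hs : ∀ i, 0 < s i) :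
    HasSum (fun d : {d : Fin r → ℕ // StrictAnti d} => ∏ m, powerSumInfty F (d.1 m) (s m))
      (zetaA F s) := by
  let g : MonicTuple F r → {d : Fin r → ℕ // StrictAnti d} :=
    fun a => ⟨fun m => (a.1 m).natDegree, a.2.2⟩
  have h := (summable_zetaTerm (F := F) s hs).hasSum.tsum_fiberwise g
  rw [show (fun d : {d : Fin r → ℕ // StrictAnti d} => ∏ m, powerSumInfty F (d.1 m) (s m)) = _
    from funext fun d => ?_]
  · exact h
  let e : {a // a ∈ Fintype.piFinset fun m => monics F (d.1 m)} ≃ g ⁻¹' {d} :=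
    { toFun := fun a => ⟨⟨a.1, fun m => (mem_monics.mp (Fintype.mem_piFinset.mp a.2 m)).1, by
          have h : (fun m => (a.1 m).natDegree) = d.1 :=
            funext fun m => (mem_monics.mp (Fintype.mem_piFinset.mp a.2 m)).2
          rw [h]
          exact d.2⟩,
        Subtype.ext (funext fun m => (mem_monics.mp (Fintype.mem_piFinset.mp a.2 m)).2)⟩
      invFun := fun a => ⟨a.1.1, Fintype.mem_piFinset.mpr fun m => mem_monics.mpr
        ⟨a.1.2.1 m, congrFun (congrArg Subtype.val a.2) m⟩⟩
      left_inv := fun _ => rfl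
      right_inv := fun _ => rfl }
  rw [← e.tsum_eq]
  have h1 : ∀ a, zetaTerm F s (e a : MonicTuple F r) = ∏ m, (toInfty F (a.1 m) ^ s m)⁻¹ := by
    intro a
    rw [zetaTerm, one_div, ← Finset.prod_inv_distrib]
    rfl
  rw [tsum_congr h1]
  rw [Finset.tsum_subtype (Fintype.piFinset fun m => monics F (d.1 m))
    (fun a => ∏ m, (toInfty F (a m) ^ s m)⁻¹),
    Finset.prod_congr rfl fun m _ => powerSumInfty_eq (d.1 m) (s m), Finset.prod_univ_sum]

/-- The general term of the multiple polylogarithm, at a tuple of exponents. -/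
def liTerm {r : ℕ} (s : Fin r → ℕ) (u : Fin r → F[X]) (i : Fin r → ℕ) :
    RatFunc.CompletionAtInfty F :=
  ∏ m, toInfty F (u m) ^ q F ^ i m / toInfty F (L F (i m)) ^ s m

lemma starTerm_word {r : ℕ} (w : Word r) (s : Fin r → ℕ) (u : Fin r → F[X])
    (i : {i : Fin w.dep → ℕ // Antitone i}) :
    starTerm F (w.addTuple s) (fun m => toInfty F (w.mulTuple u m)) i =
      liTerm s u (i.1 ∘ w.blockFin) := by
  rw [starTerm, ← Finset.prod_div_distrib, liTerm, ← Finset.prod_fiberwise _ w.blockFin]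
  refine Finset.prod_congr rfl fun m _ => ?_
  rw [Word.addTuple, Word.mulTuple, Word.filter_block_eq, map_prod, ← Finset.prod_pow,
    ← Finset.prod_pow_eq_pow_sum, ← Finset.prod_div_distrib]
  refine Finset.prod_congr rfl fun j hj => ?_
  rw [Function.comp_apply, (Finset.mem_filter.mp hj).2]

omit [DecidableEq (RatFunc F)] in
/-- The degree bound that ensures convergence passes from `𝔰` and `𝐮` to `w(𝔰)` and `w^×(𝐮)`; each
block is nonempty, so it contributes at least one summand `q` to spare. -/
lemma word_degree_bound {r : ℕ} (hr : 0 < r) (w : Word r) (s : Fin r → ℕ) (u : Fin r → F[X])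
    (hu : ∀ m, (q F - 1) * (u m).natDegree + q F ≤ s m * q F) (m : Fin w.dep) :
    (q F - 1) * (w.mulTuple u m).natDegree + q F ≤ w.addTuple s m * q F := by
  obtain ⟨j, rfl⟩ := w.blockFin_surjective hr m
  rw [Word.mulTuple, Word.addTuple, Finset.sum_mul]
  set t := Finset.univ.filter fun i => w.block i = (w.blockFin j : ℕ)
  have hj : j ∈ t := Finset.mem_filter.mpr ⟨Finset.mem_univ _, rfl⟩
  calc (q F - 1) * (∏ i ∈ t, u i).natDegree + q F
      ≤ (q F - 1) * ∑ i ∈ t, (u i).natDegree + ∑ i ∈ t, q F :=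
        add_le_add (Nat.mul_le_mul_left _ (natDegree_prod_le _ _))
          (Finset.single_le_sum (f := fun _ => q F) (fun _ _ => Nat.zero_le _) hj)
    _ = ∑ i ∈ t, ((q F - 1) * (u i).natDegree + q F) := by
        rw [Finset.mul_sum, Finset.sum_add_distrib]
    _ ≤ _ := Finset.sum_le_sum fun i _ => hu i

omit [DecidableEq (RatFunc F)] in
lemma natDegree_point_le {r : ℕ} (s : Fin r → ℕ) (hs : ∀ i, 0 < s i) (j : Fin r → ℕ)
    (m : Fin r) :
    (q F - 1) * (point (atH F) s j m).natDegree + q F ≤ s m * q F := by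
  have h := thetaDegLE_atH (F := F) (s m - 1) (j m)
  obtain ⟨n, hn⟩ := Nat.exists_eq_add_of_le' (hs m)
  rw [hn, Nat.add_mul, Nat.succ_mul, Nat.zero_mul, Nat.zero_add]
  rw [hn] at h
  rw [point, hn]
  exact Nat.add_le_add_right h _

lemma gammaIndex_mul_prod {r : ℕ} (s : Fin r → ℕ) (hs : ∀ i, 0 < s i) (d : Fin r → ℕ) :
    toInfty F (gammaIndex F s) * ∏ m, powerSumInfty F (d m) (s m) =
      ∑ j ∈ indexSet (atH F) s, toInfty F X ^ (∑ m, j m) * liTerm s (point (atH F) s j) d := by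
  rw [gammaIndex, map_prod, ← Finset.prod_mul_distrib,
    Finset.prod_congr rfl fun m _ => gamma_mul_powerSumInfty (d m) (hs m), Finset.prod_univ_sum]
  refine Finset.sum_congr rfl fun j _ => ?_
  rw [Finset.prod_mul_distrib, Finset.prod_pow_eq_pow_sum]
  rfl

lemma summable_starTerm_word {r : ℕ} (hr : 0 < r) (s : Fin r → ℕ) (hs : ∀ i, 0 < s i)
    (j : Fin r → ℕ) (w : Word r) :
    Summable (starTerm F (w.addTuple s)
      fun m => toInfty F (w.mulTuple (point (atH F) s j) m)) :=
  summable_starTerm _ _ (word_degree_bound hr w s _ (natDegree_point_le s hs j))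

theorem gammaIndex_mul_zetaA {r : ℕ} (hr : 0 < r) (s : Fin r → ℕ) (hs : ∀ i, 0 < s i) :
    toInfty F (gammaIndex F s) * zetaA F s =
      ∑ j ∈ indexSet (atH F) s, ∑ w : Word r,
        toInfty F (coefficient F j) * (-1) ^ (w.dep - 1) *
          starLi F (w.addTuple s) fun m => toInfty F (w.mulTuple (point (atH F) s j) m) := by
  have h1 := (hasSum_zetaA (F := F) s hs).mul_left (toInfty F (gammaIndex F s))
  simp only [gammaIndex_mul_prod s hs] at h1
  have h2 : ∀ j ∈ indexSet (atH F) s, _ := fun j _ =>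
    (hasSum_strictAnti hr (liTerm s (point (atH F) s j)) fun w =>
      (summable_starTerm_word hr s hs j w).congr fun i => starTerm_word w s _ i).mul_left
        (toInfty F X ^ (∑ m, j m))
  rw [h1.unique (hasSum_sum h2)]
  refine Finset.sum_congr rfl fun j _ => ?_
  rw [Finset.mul_sum]
  refine Finset.sum_congr rfl fun w _ => ?_
  rw [starLi, tsum_congr (starTerm_word w s (point (atH F) s j)), coefficient, map_mul, map_pow,
    map_pow, map_neg, map_one]
  ring

end Values

end CarlitzMZV

end

theorem theorem5p2p4 (F : Type*) [Field F] [Fintype F] [DecidableEq (RatFunc F)]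
    (r : ℕ) (hr : 0 < r) (s : Fin r → ℕ) (hs : ∀ i, 0 < s i) :
    ∃ H : ℕ → F[X][X], CarlitzMZV.IsAndersonThakur F H ∧
      (∀ j ∈ CarlitzMZV.indexSet H s, ∀ w : CarlitzMZV.Word r,
        (∀ m, 0 < w.addTuple s m) ∧
        ∑ m, w.addTuple s m = ∑ i, s i ∧
        w.dep ≤ r ∧
        Summable (CarlitzMZV.starTerm F (w.addTuple s)
          (fun m => CarlitzMZV.toInfty F (w.mulTuple (CarlitzMZV.point H s j) m)))) ∧
      Summable (CarlitzMZV.zetaTerm F s) ∧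
      CarlitzMZV.toInfty F (CarlitzMZV.gammaIndex F s) * CarlitzMZV.zetaA F s =
        ∑ j ∈ CarlitzMZV.indexSet H s, ∑ w : CarlitzMZV.Word r,
          CarlitzMZV.toInfty F (CarlitzMZV.coefficient F j) * (-1) ^ (w.dep - 1) *
            CarlitzMZV.starLi F (w.addTuple s)
              (fun m => CarlitzMZV.toInfty F (w.mulTuple (CarlitzMZV.point H s j) m)) :=
  ⟨CarlitzMZV.atH F, CarlitzMZV.isAndersonThakur_atH F,
    fun j _ w => ⟨w.addTuple_pos hr hs, w.sum_addTuple s, w.dep_le hr,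
      CarlitzMZV.summable_starTerm_word hr s hs j w⟩,
    CarlitzMZV.summable_zetaTerm s hs, CarlitzMZV.gammaIndex_mul_zetaA hr s hs⟩
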